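/- Theorem 3.5 (Goursat's second theorem). Let $R\in\mathbb{C}[t]$ be a polynomial of degree $3$ or $4$ with simple roots. Its roots in $\mathbb{P}^1(\mathbb{C})=\mathbb{C}\cup\{\infty\}$ are its four complex roots if $\deg R=4$, and its three complex roots together with $\infty$ if $\deg R=3$. Let $S_1,S_2,S_3\in\operatorname{PGL}_2(\mathbb{C})$ be the three Möbius involutions that permute these four points in pairs, that is, three distinct elements of order two, each of which maps the set of these four points to itself and fixes none of them. Let $F\in\mathbb{C}(t)$. If $$F+F\circ S_1+F\circ S_2+F\circ S_3=0$$ identically, then the integral $\int F\,dt/\sqrt{R}$ is pseudo-elliptic, i.e. elementary: in the differential field $K=\mathbb{C}(t)(y)$, $y^2=R$, with the derivation extending $d/dt$, the element $f=F/y$ has an elementary integral, which means that there are a differential field extension $L\supseteq K$ and an element $g\in L$ with $g'=f$, and a tower of fields $K=K_0\subseteq K_1\subseteq\dots\subseteq K_n=L$ such that for each $i<n$ one has $K_{i+1}=K_i(\theta_i)$, where $\theta_i$ is algebraic over $K_i$, or $\theta_i\neq 0$ is an exponential ($\theta_i'/\theta_i=\eta'$ for some $\eta\in K_i$), or $\theta_i$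 is a logarithm ($\theta_i'=\eta'/\eta$ for some $\eta\in K_i$, $\eta\ne 0$). -/

import Mathlib

namespace Goursat

open Polynomial
open scoped Differential IntermediateField

noncomputable section

/-! ### The differential field `ℂ(t)` -/

/-- `d/dt` on `ℂ(t)`, by the quotient rule applied to the reduced fraction. -/
def ddt (f : RatFunc ℂ) : RatFunc ℂ :=
  (algebraMap ℂ[X] (RatFunc ℂ) (derivative f.num) * algebraMap ℂ[X] (RatFunc ℂ) f.denom -
      algebraMap ℂ[X] (RatFunc ℂ) f.num * algebraMap ℂ[X] (RatFunc ℂ) (derivative f.denom)) /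
    algebraMap ℂ[X] (RatFunc ℂ) f.denom ^ 2

/-- The quotient rule holds for every representation of a rational function as a fraction. -/
theorem ddt_div (p q : ℂ[X]) (hq : q ≠ 0) :
    ddt (algebraMap ℂ[X] (RatFunc ℂ) p / algebraMap ℂ[X] (RatFunc ℂ) q) =
      (algebraMap ℂ[X] (RatFunc ℂ) (derivative p) * algebraMap ℂ[X] (RatFunc ℂ) q -
          algebraMap ℂ[X] (RatFunc ℂ) p * algebraMap ℂ[X] (RatFunc ℂ) (derivative q)) /
        algebraMap ℂ[X] (RatFunc ℂ) q ^ 2 := by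
  set f : RatFunc ℂ := algebraMap ℂ[X] (RatFunc ℂ) p / algebraMap ℂ[X] (RatFunc ℂ) q with hf
  have hd : f.denom ≠ 0 := f.denom_ne_zero
  have hq' : algebraMap ℂ[X] (RatFunc ℂ) q ≠ 0 := RatFunc.algebraMap_ne_zero hq
  have hd' : algebraMap ℂ[X] (RatFunc ℂ) f.denom ≠ 0 := RatFunc.algebraMap_ne_zero hd
  have h : f.num * q = p * f.denom := by
    apply RatFunc.algebraMap_injective ℂ
    have h1 := f.num_div_denom
    rw [hf, div_eq_div_iff (by rw [← hf]; exact hd') hq', ← hf] at h1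
    simpa using h1
  have h' := congrArg derivative h
  simp only [derivative_mul] at h'
  have e := congrArg (algebraMap ℂ[X] (RatFunc ℂ)) h
  have e' := congrArg (algebraMap ℂ[X] (RatFunc ℂ)) h'
  simp only [map_mul, map_add] at e e'
  unfold ddt
  rw [div_eq_div_iff (pow_ne_zero 2 hd') (pow_ne_zero 2 hq')]
  linear_combination (algebraMap ℂ[X] (RatFunc ℂ) q * algebraMap ℂ[X] (RatFunc ℂ) f.denom) * e' -
    (algebraMap ℂ[X] (RatFunc ℂ) (derivative q) * algebraMap ℂ[X] (RatFunc ℂ) f.denom +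
      algebraMap ℂ[X] (RatFunc ℂ) q * algebraMap ℂ[X] (RatFunc ℂ) (derivative f.denom)) * e

theorem exists_frac (f : RatFunc ℂ) : ∃ p q : ℂ[X], q ≠ 0 ∧
    f = algebraMap ℂ[X] (RatFunc ℂ) p / algebraMap ℂ[X] (RatFunc ℂ) q :=
  ⟨f.num, f.denom, f.denom_ne_zero, f.num_div_denom.symm⟩

theorem ddt_add (f g : RatFunc ℂ) : ddt (f + g) = ddt f + ddt g := by
  obtain ⟨p, q, hq, rfl⟩ := exists_frac f
  obtain ⟨r, s, hs, rfl⟩ := exists_frac g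
  have hq' := RatFunc.algebraMap_ne_zero hq
  have hs' := RatFunc.algebraMap_ne_zero hs
  have := ddt_div (p * s + q * r) (q * s) (mul_ne_zero hq hs)
  rw [ddt_div p q hq, ddt_div r s hs, div_add_div _ _ hq' hs', ← map_mul, ← map_mul, ← map_add,
    ← map_mul, this]
  simp only [derivative_mul, map_add, map_mul]
  field_simp
  ring

theorem ddt_mul (f g : RatFunc ℂ) : ddt (f * g) = f * ddt g + g * ddt f := by
  obtain ⟨p, q, hq, rfl⟩ := exists_frac f
  obtain ⟨r, s, hs, rfl⟩ := exists_frac g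
  have hq' := RatFunc.algebraMap_ne_zero hq
  have hs' := RatFunc.algebraMap_ne_zero hs
  have := ddt_div (p * r) (q * s) (mul_ne_zero hq hs)
  rw [ddt_div p q hq, ddt_div r s hs, div_mul_div_comm, ← map_mul, ← map_mul, this]
  simp only [derivative_mul, map_add, map_mul]
  field_simp
  ring

/-- An additive map satisfying the Leibniz rule makes a field a differential field. -/
@[reducible]
def differentialOfLeibniz {K : Type} [Field K] (d : K → K) (hadd : ∀ f g, d (f + g) = d f + d g)
    (hmul : ∀ f g, d (f * g) = f * d g + g * d f) : Differential K where
  deriv := Derivation.mk' (AddMonoidHom.mk' d hadd).toIntLinearMap hmul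

/-- `ℂ(t)` as a differential field, with derivation `d/dt`. -/
instance : Differential (RatFunc ℂ) :=
  differentialOfLeibniz ddt ddt_add ddt_mul

/-! ### Elementary extensions and elementary integrals -/

/-- `L` is an elementary extension of `K`: there is a tower `K = E 0 ⊆ ⋯ ⊆ E n = L` in which
`E (i + 1) = (E i)(θ)` where `θ` is algebraic over `E i`, or an exponential of an element of `E i`,
or a logarithm of a non-zero element of `E i`.  (Every `E i` is then stable under the derivation of
`L`.) -/
def IsElementaryExtension (K L : Type) [Field K] [Field L] [Differential L] [Algebra K L] : Prop :=
  ∃ (n : ℕ) (E : ℕ → IntermediateField K L), E 0 = ⊥ ∧ E n = ⊤ ∧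
    ∀ i < n, ∃ θ : L, E (i + 1) = E i ⊔ K⟮θ⟯ ∧
      (IsAlgebraic (E i) θ ∨
        (θ ≠ 0 ∧ ∃ η ∈ E i, θ′ / θ = η′) ∨
        (∃ η ∈ E i, η ≠ 0 ∧ θ′ = η′ / η))

/-- `f ∈ K` has an elementary integral: it has an antiderivative in some elementary extension
of the differential field `K`. -/
def HasElementaryIntegral {K : Type} [Field K] [Differential K] (f : K) : Prop :=
  ∃ (L : Type) (_ : Field L) (_ : Differential L) (_ : Algebra K L) (_ : DifferentialAlgebra K L),
    IsElementaryExtension K L ∧ ∃ g : L, g′ = algebraMap K L f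

/-- `∫ F dt / √R` is pseudo-elliptic: in the differential field `K = ℂ(t)(y)`, `y² = R`, the element
`F / y` has an elementary integral.  The field `K` is unique up to isomorphism, so it is specified
by its defining property; it exists by `exists_sqrt_field`. -/
def IsPseudoElliptic (R : ℂ[X]) (F : RatFunc ℂ) : Prop :=
  ∀ (K : Type) [Field K] [Differential K] [Algebra (RatFunc ℂ) K]
    [DifferentialAlgebra (RatFunc ℂ) K] (y : K),
    y ^ 2 = algebraMap (RatFunc ℂ) K (algebraMap ℂ[X] (RatFunc ℂ) R) →
    (RatFunc ℂ)⟮y⟯ = ⊤ →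
    HasElementaryIntegral (algebraMap (RatFunc ℂ) K F / y)

theorem exists_sqrt_field (R : ℂ[X]) :
    ∃ (K : Type) (_ : Field K) (_ : Differential K) (_ : Algebra (RatFunc ℂ) K)
      (_ : DifferentialAlgebra (RatFunc ℂ) K) (y : K),
      y ^ 2 = algebraMap (RatFunc ℂ) K (algebraMap ℂ[X] (RatFunc ℂ) R) ∧
      (RatFunc ℂ)⟮y⟯ = ⊤ := by
  obtain ⟨z, hz⟩ := IsAlgClosed.exists_pow_nat_eq
    (algebraMap (RatFunc ℂ) (AlgebraicClosure (RatFunc ℂ)) (algebraMap ℂ[X] (RatFunc ℂ) R))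
    (n := 2) (by norm_num)
  have : CharZero (RatFunc ℂ) := algebraRat.charZero _
  have : FiniteDimensional (RatFunc ℂ) (RatFunc ℂ)⟮z⟯ :=
    IntermediateField.adjoin.finiteDimensional (Algebra.IsIntegral.isIntegral z)
  let := Differential.differentialFiniteDimensional (RatFunc ℂ) (RatFunc ℂ)⟮z⟯
  refine ⟨(RatFunc ℂ)⟮z⟯, inferInstance, inferInstance, inferInstance,
    Differential.differentialAlgebraFiniteDimensional,
    IntermediateField.AdjoinSimple.gen (RatFunc ℂ) z, ?_, ?_⟩
  · apply Subtype.ext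
    simpa using hz
  · apply IntermediateField.lift_injective
    rw [IntermediateField.lift_adjoin_simple, IntermediateField.lift_top,
      IntermediateField.AdjoinSimple.coe_gen]

/-! ### Möbius transformations

A Möbius transformation is an element of `PGL₂(ℂ)`; it is given by an invertible matrix
`M = [a, b; c, d]`, which acts on `ℙ¹(ℂ) = ℂ ∪ {∞}` by `t ↦ (a t + b) / (c t + d)`. -/

/-- The rational function `(a t + b) / (c t + d)`. -/
def mobius (M : GL (Fin 2) ℂ) : RatFunc ℂ :=
  (RatFunc.C (M 0 0) * RatFunc.X + RatFunc.C (M 0 1)) /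
    (RatFunc.C (M 1 0) * RatFunc.X + RatFunc.C (M 1 1))

/-- The composition `F ∘ S` where `S` is the Möbius transformation given by `M`. -/
def compMobius (F : RatFunc ℂ) (M : GL (Fin 2) ℂ) : RatFunc ℂ :=
  F.eval RatFunc.C (mobius M)

/-- The roots of `R` in `ℙ¹(ℂ)`: its complex roots, and also `∞` if `R` is a cubic. -/
def projRoots (R : ℂ[X]) : Set (OnePoint ℂ) :=
  {x | (∃ r : ℂ, R.IsRoot r ∧ x = (r : OnePoint ℂ)) ∨ (R.natDegree = 3 ∧ x = OnePoint.infty)}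

/-- The Möbius transformation given by `M` is an involution (an element of order two of `PGL₂(ℂ)`)
that permutes the roots of `R` in pairs, that is, maps the set of roots to itself and fixes none. -/
def IsPairingInvolution (R : ℂ[X]) (M : GL (Fin 2) ℂ) : Prop :=
  orderOf (Matrix.ProjGenLinGroup.mk M) = 2 ∧ ∀ x ∈ projRoots R, M • x ∈ projRoots R ∧ M • x ≠ x

end

end Goursat

/-
Since `S₃ = S₁ ∘ S₂`, the hypothesis splits `F` into `G = (F - F ∘ S₁) / 2`, which changes sign
under `S₁`, and `H = (F + F ∘ S₁) / 2`, which changes sign under `S₂`. Let `S` be one of the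
involutions and `F ∘ S = -F`. The matrix of `S` has trace zero, so a quadratic `p` whose roots are
exchanged by `S` satisfies `p ∘ S = -S′ p`. Write `R = p q` for two such quadratics. Then
`v = p / q` is `S`-invariant and generates the fixed field of `S`, and by the chain rule
`F / (q v′)` is `S`-invariant too, hence a rational function of `v`. For `w = y / q` we have
`w² = v`, so `F / y = 2 w′ F / (q v′)` is `w′` times a rational function of `w`, and partial
fractions over `ℂ` integrate it by logarithms.
-/

namespace Goursat

open Polynomial
open scoped Differential IntermediateField

noncomputable section

section LiouvilleForms

variable (k K : Type*) [Field k] [Field K] [Algebra k K] [Differential K]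

/-- The elements of `K` which, over a field `k` of constants, have an integral of the shape given
by Liouville's theorem: the derivative of an element of `K` plus a `k`-linear combination of
logarithmic derivatives of elements of `K`. -/
def liouvilleForms : Submodule k K :=
  Submodule.span k (Set.range (Differential.deriv : K → K) ∪
    Set.range fun a : Kˣ => Differential.logDeriv (a : K))

variable {k K}

theorem deriv_mem_liouvilleForms (g : K) : g′ ∈ liouvilleForms k K :=
  Submodule.subset_span (.inl ⟨g, rfl⟩)

theorem logDeriv_mem_liouvilleForms (a : K) : Differential.logDeriv a ∈ liouvilleForms k K := by
  rcases eq_or_ne a 0 with rfl | ha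
  · simp
  · exact Submodule.subset_span (.inr ⟨Units.mk0 a ha, rfl⟩)

theorem deriv_smul (hk : ∀ c : k, (algebraMap k K c)′ = 0) (c : k) (f : K) :
    (c • f)′ = c • f′ := by
  simp [Algebra.smul_def, hk]

theorem exists_eq_deriv_add_sum_of_mem_liouvilleForms (hk : ∀ c : k, (algebraMap k K c)′ = 0)
    {f : K} (hf : f ∈ liouvilleForms k K) :
    ∃ (g : K) (n : ℕ) (c : Fin n → k) (a : Fin n → Kˣ),
      f = g′ + ∑ i, c i • Differential.logDeriv (a i : K) := by
  rw [liouvilleForms, Submodule.span_union, Submodule.mem_sup] at hf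
  obtain ⟨d, hd, e, he, rfl⟩ := hf
  obtain ⟨g, rfl⟩ : ∃ g : K, g′ = d := by
    induction hd using Submodule.span_induction with
    | mem _ hd => exact hd
    | zero => exact ⟨0, map_zero _⟩
    | add d₁ d₂ _ _ h₁ h₂ =>
      obtain ⟨⟨g₁, rfl⟩, g₂, rfl⟩ := And.intro h₁ h₂
      exact ⟨g₁ + g₂, map_add _ _ _⟩
    | smul c d _ hd =>
      obtain ⟨g, rfl⟩ := hd
      exact ⟨c • g, deriv_smul hk c g⟩
  obtain ⟨n, c, b, rfl⟩ := Submodule.mem_span_set'.1 he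
  choose a ha using fun i => (b i).2
  exact ⟨g, n, c, a, by simp only [← ha]⟩

end LiouvilleForms

section RationalSubstitution

variable {k K : Type*} [Field k] [Field K] [Algebra k K] {w : K}

theorem aeval_div_aeval_mem [IsAlgClosed k] {V : Submodule k K} (hpow : ∀ n : ℕ, w ^ n ∈ V)
    (hinv : ∀ (a : k) (n : ℕ), (w - algebraMap k K a)⁻¹ ^ (n + 1) ∈ V)
    (hw : ∀ a : k, w - algebraMap k K a ≠ 0) (r s : k[X]) :
    aeval w r / aeval w s ∈ V := by
  classical
  let : Algebra k[X] K := (aeval w).toAlgebra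
  have hmap (p : k[X]) : algebraMap k[X] K p = aeval w p := rfl
  obtain ⟨q, t, ht, h⟩ := mul_prod_pow_inverse_eq_quo_add_sum_rem_mul_pow_inverse (K := K)
    (s := s.roots.toFinset) r (g := fun a => X - C a) (fun a _ => monic_X_sub_C a)
    (fun a _ b _ hab => isCoprime_X_sub_C_of_isUnit_sub (sub_ne_zero.2 hab).isUnit)
    (fun a => s.rootMultiplicity a) (gi := fun a => (w - algebraMap k K a)⁻¹)
    (fun a _ => by simp [hmap, hw a])
  have hs : aeval w s = algebraMap k K s.leadingCoeff *
      ∏ a ∈ s.roots.toFinset, (w - algebraMap k K a) ^ s.rootMultiplicity a := by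
    conv_lhs => rw [(IsAlgClosed.splits s).eq_prod_roots, prod_multiset_root_eq_finset_root]
    simp
  have hrs : aeval w r / aeval w s = s.leadingCoeff⁻¹ • (aeval w q +
      ∑ a ∈ s.roots.toFinset, ∑ j, aeval w (t a j) * (w - algebraMap k K a)⁻¹ ^ (j.1 + 1)) := by
    simp only [hmap] at h
    rw [← h, hs, Algebra.smul_def, map_inv₀, div_eq_mul_inv, mul_inv, ← Finset.prod_inv_distrib]
    simp only [inv_pow]
    ring
  rw [hrs]
  refine V.smul_mem _ (V.add_mem ?_ (V.sum_mem fun a ha => V.sum_mem fun j _ => ?_))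
  · rw [aeval_eq_sum_range]
    exact V.sum_mem fun i _ => V.smul_mem _ (hpow i)
  · have hdeg : (t a j).degree ≤ 0 := Nat.WithBot.lt_one_iff_le_zero.1 (by simpa using ht a ha j)
    rw [eq_C_of_degree_le_zero hdeg, aeval_C, ← Algebra.smul_def]
    exact V.smul_mem _ (hinv a j)

variable [CharZero k] [Differential K]

theorem pow_mul_deriv_mem_liouvilleForms (w : K) (n : ℕ) : w ^ n * w′ ∈ liouvilleForms k K := by
  have hn : (n + 1 : k) ≠ 0 := n.cast_add_one_ne_zero
  have h : w ^ n * w′ = (n + 1 : k)⁻¹ • (w ^ (n + 1))′ := by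
    rw [eq_inv_smul_iff₀ hn]
    simp [Algebra.smul_def, Derivation.leibniz_pow]
  rw [h]
  exact Submodule.smul_mem _ _ (deriv_mem_liouvilleForms _)

theorem inv_pow_mul_deriv_mem_liouvilleForms (w : K) (n : ℕ) :
    w⁻¹ ^ (n + 1) * w′ ∈ liouvilleForms k K := by
  cases n with
  | zero => simpa [Differential.logDeriv, div_eq_inv_mul] using logDeriv_mem_liouvilleForms w
  | succ n =>
    have h : w⁻¹ ^ (n + 2) * w′ = -(w⁻¹ ^ n * w⁻¹′) := by
      simp only [Derivation.leibniz_inv, smul_eq_mul]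
      ring
    rw [h]
    exact neg_mem (pow_mul_deriv_mem_liouvilleForms w⁻¹ n)

theorem aeval_div_aeval_mul_deriv_mem_liouvilleForms [IsAlgClosed k]
    (hk : ∀ c : k, (algebraMap k K c)′ = 0) (w : K) (r s : k[X]) :
    aeval w r / aeval w s * w′ ∈ liouvilleForms k K := by
  rcases eq_or_ne w′ 0 with hw' | hw'
  · simp [hw']
  have hw (a : k) : w - algebraMap k K a ≠ 0 := by
    intro h
    exact hw' (sub_eq_zero.1 h ▸ hk a)
  refine aeval_div_aeval_mem (V := (liouvilleForms k K).comap (LinearMap.mulRight k w′))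
    (pow_mul_deriv_mem_liouvilleForms w) (fun a n => ?_) hw r s
  simpa [hk] using inv_pow_mul_deriv_mem_liouvilleForms (k := k) (w - algebraMap k K a) n

end RationalSubstitution

section AdjoiningPrimitives

section DualNumberLift

variable {A : Type*} {L : Type} [CommRing A] [Field L] [Algebra A L] [IsFractionRing A L]

theorem isUnit_of_fst_eq_algebraMap {φ : A →+* DualNumber L}
    (hφ : ∀ a, (φ a).fst = algebraMap A L a) (a : nonZeroDivisors A) : IsUnit (φ a) := by
  rw [TrivSqZeroExt.isUnit_iff_isUnit_fst, hφ]
  exact IsLocalization.map_units L a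

theorem fst_lift_eq {φ : A →+* DualNumber L} (hφ : ∀ a, (φ a).fst = algebraMap A L a) (x : L) :
    (IsLocalization.lift (isUnit_of_fst_eq_algebraMap hφ) x : DualNumber L).fst = x := by
  suffices (TrivSqZeroExt.fstHom L L L).toRingHom.comp
      (IsLocalization.lift (isUnit_of_fst_eq_algebraMap hφ)) = RingHom.id L from congr($this x)
  refine IsLocalization.ringHom_ext (nonZeroDivisors A) (RingHom.ext fun a => ?_)
  simp [hφ]

/-- The derivation of the fraction field `L` of `A` that restricts to `d` on `A`, where `d : A → L`
is encoded as the ring homomorphism `φ : a ↦ a + d(a) ε` to the dual numbers over `L`. -/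
@[reducible]
def differentialOfDualNumber (φ : A →+* DualNumber L) (hφ : ∀ a, (φ a).fst = algebraMap A L a) :
    Differential L :=
  differentialOfLeibniz
    (fun x => (IsLocalization.lift (isUnit_of_fst_eq_algebraMap hφ) x : DualNumber L).snd)
    (fun f g => by simp) (fun f g => by simp [fst_lift_eq hφ, mul_comm])

theorem deriv_algebraMap_of_dualNumber (φ : A →+* DualNumber L)
    (hφ : ∀ a, (φ a).fst = algebraMap A L a) (a : A) :
    letI := differentialOfDualNumber φ hφ
    (algebraMap A L a)′ = (φ a).snd :=
  congrArg TrivSqZeroExt.snd (IsLocalization.lift_eq (isUnit_of_fst_eq_algebraMap hφ) a)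

end DualNumberLift

/-- The ring homomorphism `a ↦ a + a′ ε` from a differential ring `K` to the dual numbers over a
`K`-algebra `A`. -/
def firstOrderTaylor (K A : Type*) [CommRing K] [Differential K] [CommRing A] [Algebra K A] :
    K →+* DualNumber A where
  toFun a := TrivSqZeroExt.inl (algebraMap K A a) + TrivSqZeroExt.inr (algebraMap K A a′)
  map_one' := by ext <;> simp
  map_zero' := by ext <;> simp
  map_add' x y := by ext <;> simp [-DualNumber.inr_eq_smul_eps]
  map_mul' x y := by ext <;> simp [-DualNumber.inr_eq_smul_eps, mul_comm]

variable {K σ : Type} [Field K] [Differential K]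

/-- The ring homomorphism `p ↦ p + p′ ε` for the derivation of `K[X i | i : σ]` that extends the
derivation of `K` and maps `X i` to `b i`. -/
def primitivesTaylor (b : σ → K) :
    MvPolynomial σ K →+* DualNumber (FractionRing (MvPolynomial σ K)) :=
  MvPolynomial.eval₂Hom (firstOrderTaylor K _) fun i =>
    TrivSqZeroExt.inl (algebraMap (MvPolynomial σ K) _ (MvPolynomial.X i)) +
      TrivSqZeroExt.inr (algebraMap K _ (b i))

theorem fst_primitivesTaylor (b : σ → K) (p : MvPolynomial σ K) :
    (primitivesTaylor b p).fst = algebraMap _ (FractionRing (MvPolynomial σ K)) p := by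
  suffices (TrivSqZeroExt.fstHom (FractionRing (MvPolynomial σ K)) _ _).toRingHom.comp
      (primitivesTaylor b) = algebraMap _ (FractionRing (MvPolynomial σ K)) from congr($this p)
  refine MvPolynomial.ringHom_ext (fun a => ?_) fun i => ?_
  · simp [primitivesTaylor, firstOrderTaylor, IsScalarTower.algebraMap_apply K (MvPolynomial σ K)
      (FractionRing (MvPolynomial σ K)), MvPolynomial.algebraMap_eq]
  · simp [primitivesTaylor]

/-- The derivation of `K(X i | i : σ)` that extends the derivation of `K` and maps `X i` to
`b i`. -/
@[reducible]
def differentialOfPrimitives (b : σ → K) : Differential (FractionRing (MvPolynomial σ K)) :=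
  differentialOfDualNumber (primitivesTaylor b) (fst_primitivesTaylor b)

theorem differentialAlgebra_ofPrimitives (b : σ → K) :
    letI := differentialOfPrimitives b
    DifferentialAlgebra K (FractionRing (MvPolynomial σ K)) := by
  let := differentialOfPrimitives b
  refine ⟨fun a => ?_⟩
  rw [IsScalarTower.algebraMap_apply K (MvPolynomial σ K), deriv_algebraMap_of_dualNumber]
  simp [-DualNumber.inr_eq_smul_eps, primitivesTaylor, firstOrderTaylor, MvPolynomial.algebraMap_eq]

theorem deriv_X_ofPrimitives (b : σ → K) (i : σ) :
    letI := differentialOfPrimitives b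
    (algebraMap (MvPolynomial σ K) (FractionRing (MvPolynomial σ K)) (MvPolynomial.X i))′ =
      algebraMap K _ (b i) := by
  rw [deriv_algebraMap_of_dualNumber]
  simp [-DualNumber.inr_eq_smul_eps, primitivesTaylor]

theorem adjoin_range_X_fractionRing (K σ : Type*) [Field K] :
    IntermediateField.adjoin K (Set.range fun i : σ =>
      algebraMap (MvPolynomial σ K) (FractionRing (MvPolynomial σ K)) (MvPolynomial.X i)) = ⊤ := by
  let g := IsScalarTower.toAlgHom K (MvPolynomial σ K) (FractionRing (MvPolynomial σ K))
  have hg : g.range = Algebra.adjoin K (Set.range fun i : σ => g (MvPolynomial.X i)) := by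
    rw [Set.range_comp' g, ← AlgHom.map_adjoin, MvPolynomial.adjoin_range_X, Algebra.map_top]
  exact (IsFractionRing.algHom_fieldRange_eq_of_comp_eq_of_range_eq
    (f := AlgHom.id K (FractionRing (MvPolynomial σ K))) rfl hg).symm.trans
    (AlgHom.fieldRange_eq_top.2 Function.surjective_id)

end AdjoiningPrimitives

theorem isElementaryExtension_of_adjoin_logarithms {K L : Type} [Field K] [Differential K]
    [Field L] [Differential L] [Algebra K L] [DifferentialAlgebra K L] {n : ℕ} (a : Fin n → Kˣ)
    {θ : Fin n → L} (hθ : ∀ i, (θ i)′ = algebraMap K L (Differential.logDeriv (a i : K)))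
    (htop : IntermediateField.adjoin K (Set.range θ) = ⊤) : IsElementaryExtension K L := by
  refine ⟨n, fun m => IntermediateField.adjoin K (θ '' {i | (i : ℕ) < m}), by simp, ?_,
    fun m hm => ⟨θ ⟨m, hm⟩, ?_, .inr (.inr ⟨algebraMap K L (a ⟨m, hm⟩),
      IntermediateField.algebraMap_mem _ _, by simp, ?_⟩)⟩⟩
  · simpa [Set.eq_univ_of_forall] using htop
  · have hsucc : {i : Fin n | (i : ℕ) < m + 1} = {i : Fin n | (i : ℕ) < m} ∪ {⟨m, hm⟩} := by
      ext i
      simp [Fin.ext_iff, le_iff_eq_or_lt]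
    simp only [hsucc, Set.image_union, Set.image_singleton, IntermediateField.adjoin_union]
  · rw [hθ, Differential.logDeriv, map_div₀, deriv_algebraMap]

theorem hasElementaryIntegral_of_mem_liouvilleForms {k : Type*} {K : Type} [Field k] [Field K]
    [Algebra k K] [Differential K] (hk : ∀ c : k, (algebraMap k K c)′ = 0) {f : K}
    (hf : f ∈ liouvilleForms k K) : HasElementaryIntegral f := by
  obtain ⟨g, n, c, a, rfl⟩ := exists_eq_deriv_add_sum_of_mem_liouvilleForms hk hf
  let b (i : Fin n) : K := Differential.logDeriv (a i : K)
  let := differentialOfPrimitives b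
  have := differentialAlgebra_ofPrimitives b
  let L := FractionRing (MvPolynomial (Fin n) K)
  let θ (i : Fin n) : L := algebraMap (MvPolynomial (Fin n) K) L (MvPolynomial.X i)
  have hθ (i : Fin n) : (θ i)′ = algebraMap K L (b i) := deriv_X_ofPrimitives b i
  refine ⟨L, inferInstance, inferInstance, inferInstance, inferInstance,
    isElementaryExtension_of_adjoin_logarithms a hθ (adjoin_range_X_fractionRing K (Fin n)),
    algebraMap K L g + ∑ i, algebraMap K L (algebraMap k K (c i)) * θ i, ?_⟩
  simp [deriv_algebraMap, hk, hθ, b, Algebra.smul_def]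

section QuadraticSubfield

theorem mem_bot_of_apply_eq_of_finrank_prime {F L : Type*} [Field F] [Field L] [Algebra F L]
    (hFL : (Module.finrank F L).Prime) {σ : L →ₐ[F] L} (hσ : σ ≠ AlgHom.id F L) {x : L}
    (hx : σ x = x) : x ∈ (⊥ : Subalgebra F L) := by
  have := Subalgebra.isSimpleOrder_of_finrank_prime F L hFL
  have hbot := (eq_bot_or_eq_top (AlgHom.equalizer σ (AlgHom.id F L))).resolve_right
    (mt AlgHom.equalizer_eq_top.1 hσ)
  rwa [← hbot]

theorem apply_eq_of_mem_adjoin_simple {k L : Type*} [Field k] [Field L] [Algebra k L]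
    {σ : L →ₐ[k] L} {v : L} (hv : σ v = v) {x : L} (hx : x ∈ k⟮v⟯) : σ x = x := by
  obtain ⟨f, g, rfl⟩ := (IntermediateField.mem_adjoin_simple_iff k x).1 hx
  rw [map_div₀, ← aeval_algHom_apply, ← aeval_algHom_apply, hv]

theorem mem_adjoin_simple_of_apply_eq {k L : Type*} [Field k] [Field L] [Algebra k L]
    {σ : L →ₐ[k] L} (hσ : σ ≠ AlgHom.id k L) {v : L} (hv : σ v = v)
    (hfin : (Module.finrank k⟮v⟯ L).Prime) {x : L} (hx : σ x = x) : x ∈ k⟮v⟯ := by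
  let τ : L →ₐ[k⟮v⟯] L := { σ with commutes' := fun a => apply_eq_of_mem_adjoin_simple hv a.2 }
  have hτ : τ ≠ AlgHom.id k⟮v⟯ L := fun h => hσ (AlgHom.ext fun a => congr($h a))
  obtain ⟨a, rfl⟩ := Algebra.mem_bot.1 (mem_bot_of_apply_eq_of_finrank_prime hfin hτ hx)
  exact a.2

theorem finrank_adjoin_div_le {k : Type*} [Field k] {p q : k[X]} {d : ℕ} (hp : p.natDegree ≤ d)
    (hq : q.natDegree ≤ d) (hq0 : q ≠ 0) :
    Module.finrank k⟮(algebraMap k[X] (RatFunc k) p / algebraMap k[X] (RatFunc k) q)⟯ (RatFunc k)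
      ≤ d := by
  rw [RatFunc.finrank_eq_max_natDegree]
  rcases eq_or_ne p 0 with rfl | hp0
  · simp
  · exact max_le ((natDegree_le_of_dvd (RatFunc.num_div_dvd p hq0) hp0).trans hp)
      ((natDegree_le_of_dvd (RatFunc.denom_div_dvd p q) hq0).trans hq)

theorem finrank_adjoin_div_eq_two {k : Type*} [Field k] {σ : RatFunc k →ₐ[k] RatFunc k}
    (hσ : σ ≠ AlgHom.id k (RatFunc k)) {p q : k[X]} (hp : p.natDegree ≤ 2) (hq : q.natDegree ≤ 2)
    (hq0 : q ≠ 0) {v : RatFunc k}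
    (hv : v = algebraMap k[X] (RatFunc k) p / algebraMap k[X] (RatFunc k) q)
    (hσv : σ v = v) (hC : ¬∃ c, v = RatFunc.C c) :
    Module.finrank k⟮v⟯ (RatFunc k) = 2 := by
  have h0 : Module.finrank k⟮v⟯ (RatFunc k) ≠ 0 := by
    rwa [RatFunc.finrank_eq_max_natDegree, Ne, Nat.max_eq_zero_iff, ← RatFunc.eq_C_iff]
  have h1 : Module.finrank k⟮v⟯ (RatFunc k) ≠ 1 := by
    intro h1
    refine hσ (AlgHom.ext fun x => apply_eq_of_mem_adjoin_simple hσv ?_)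
    obtain ⟨a, rfl⟩ := Algebra.mem_bot.1
      (Subalgebra.bot_eq_top_of_finrank_eq_one h1 ▸ Algebra.mem_top : x ∈ (⊥ : Subalgebra k⟮v⟯ _))
    exact a.2
  have h2 := finrank_adjoin_div_le hp hq hq0
  rw [← hv] at h2
  omega

end QuadraticSubfield

section ChainRule

theorem deriv_aeval {k K : Type*} [Field k] [Field K] [Algebra k K] [Differential K]
    (hk : ∀ c : k, (algebraMap k K c)′ = 0) (x : K) (p : k[X]) :
    (aeval x p)′ = aeval x (derivative p) * x′ := by
  induction p using Polynomial.induction_on' with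
  | add p q hp hq => simp [hp, hq, add_mul]
  | monomial n c =>
    simp only [aeval_monomial, derivative_monomial, Derivation.leibniz, Derivation.leibniz_pow, hk,
      map_mul, map_natCast, smul_eq_mul, nsmul_eq_mul]
    ring

theorem deriv_ratFunc_algebraMap (p : ℂ[X]) :
    (algebraMap ℂ[X] (RatFunc ℂ) p)′ = algebraMap ℂ[X] (RatFunc ℂ) (derivative p) := by
  change ddt _ = _
  simpa using ddt_div p 1 one_ne_zero

theorem deriv_ratFunc_C (c : ℂ) : (RatFunc.C c)′ = 0 := by
  rw [← RatFunc.algebraMap_C, deriv_ratFunc_algebraMap, derivative_C, map_zero]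

theorem deriv_ratFunc_X : (RatFunc.X : RatFunc ℂ)′ = 1 := by
  rw [← RatFunc.algebraMap_X, deriv_ratFunc_algebraMap, derivative_X, map_one]

theorem deriv_map_ratFunc {L : Type*} [Field L] [Differential L] [Algebra ℂ L]
    (hL : ∀ c : ℂ, (algebraMap ℂ L c)′ = 0) (σ : RatFunc ℂ →ₐ[ℂ] L) (F : RatFunc ℂ) :
    (σ F)′ = σ F′ * (σ RatFunc.X)′ := by
  rw [← RatFunc.num_div_denom F]
  simp only [← RatFunc.aeval_X_left_eq_algebraMap, map_div₀, Derivation.leibniz_div,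
    ← aeval_algHom_apply, deriv_aeval hL, deriv_aeval deriv_ratFunc_C, deriv_ratFunc_X, mul_one,
    map_sub, map_mul, map_pow, map_inv₀, smul_eq_mul]
  ring

theorem algHom_ratFunc_ext {k A : Type*} [Field k] [Semiring A] [Algebra k A]
    {σ τ : RatFunc k →ₐ[k] A} (h : σ RatFunc.X = τ RatFunc.X) : σ = τ :=
  IsLocalization.algHom_ext (nonZeroDivisors k[X]) <| Polynomial.algHom_ext <| by
    change σ (algebraMap k[X] (RatFunc k) X) = τ (algebraMap k[X] (RatFunc k) X)
    rwa [RatFunc.algebraMap_X]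

end ChainRule

section Mobius

/-- The automorphy factor `c t + d` of the Möbius transformation `t ↦ (a t + b) / (c t + d)`. -/
def automorphyFactor (M : GL (Fin 2) ℂ) : RatFunc ℂ :=
  RatFunc.C (M 1 0) * RatFunc.X + RatFunc.C (M 1 1)

theorem automorphyFactor_ne_zero (M : GL (Fin 2) ℂ) : automorphyFactor M ≠ 0 := by
  intro h
  have hpoly : C (M 1 0) * X + C (M 1 1) = 0 := by
    apply RatFunc.algebraMap_injective ℂ
    simpa [automorphyFactor] using h
  have hc : M 1 0 = 0 := by simpa using congr(coeff $hpoly 1)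
  have hd : M 1 1 = 0 := by simpa using congr(coeff $hpoly 0)
  exact M.det_ne_zero (by simp [Matrix.det_fin_two, hc, hd])

theorem deriv_mobius (M : GL (Fin 2) ℂ) :
    (mobius M)′ = RatFunc.C (M : Matrix (Fin 2) (Fin 2) ℂ).det / automorphyFactor M ^ 2 := by
  have hnum : (RatFunc.C (M 0 0) * RatFunc.X + RatFunc.C (M 0 1))′ = RatFunc.C (M 0 0) := by
    simp [deriv_ratFunc_C, deriv_ratFunc_X]
  have hden : (automorphyFactor M)′ = RatFunc.C (M 1 0) := by
    simp [automorphyFactor, deriv_ratFunc_C, deriv_ratFunc_X]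
  have hD := automorphyFactor_ne_zero M
  rw [mobius, ← automorphyFactor]
  simp only [Derivation.leibniz_div, hnum, hden, smul_eq_mul, Matrix.det_fin_two, map_sub, map_mul]
  field_simp
  simp only [automorphyFactor]
  ring

theorem transcendental_mobius (M : GL (Fin 2) ℂ) : Transcendental ℂ (mobius M) := by
  refine RatFunc.transcendental_of_ne_C _ ?_
  rintro ⟨c, hc⟩
  have h := deriv_mobius M
  rw [hc, deriv_ratFunc_C, eq_comm, div_eq_zero_iff, map_eq_zero] at h
  exact h.elim M.det_ne_zero (pow_ne_zero 2 (automorphyFactor_ne_zero M))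

/-- The endomorphism `F ↦ F ∘ S` of `ℂ(t)`, where `S` is the Möbius transformation given by `M`. -/
def mobiusHom (M : GL (Fin 2) ℂ) : RatFunc ℂ →ₐ[ℂ] RatFunc ℂ :=
  RatFunc.liftAlgHom (aeval (mobius M)) <| nonZeroDivisors_le_comap_nonZeroDivisors_of_injective _
    (transcendental_iff_injective.1 (transcendental_mobius M))

theorem mobiusHom_algebraMap (M : GL (Fin 2) ℂ) (p : ℂ[X]) :
    mobiusHom M (algebraMap ℂ[X] (RatFunc ℂ) p) = aeval (mobius M) p := by
  simpa [mobiusHom] using RatFunc.liftAlgHom_apply_div (φ := aeval (mobius M))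
    (hφ := nonZeroDivisors_le_comap_nonZeroDivisors_of_injective _
      (transcendental_iff_injective.1 (transcendental_mobius M))) p 1

theorem mobiusHom_X (M : GL (Fin 2) ℂ) : mobiusHom M RatFunc.X = mobius M := by
  rw [← RatFunc.algebraMap_X, mobiusHom_algebraMap, aeval_X]

theorem mobiusHom_C (M : GL (Fin 2) ℂ) (c : ℂ) : mobiusHom M (RatFunc.C c) = RatFunc.C c :=
  (mobiusHom M).commutes c

theorem compMobius_eq_mobiusHom (F : RatFunc ℂ) (M : GL (Fin 2) ℂ) :
    compMobius F M = mobiusHom M F := by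
  conv_rhs => rw [← RatFunc.num_div_denom F, map_div₀, mobiusHom_algebraMap, mobiusHom_algebraMap]
  rfl

theorem mobiusHom_one : mobiusHom 1 = AlgHom.id ℂ (RatFunc ℂ) :=
  algHom_ratFunc_ext (by simp [mobiusHom_X, mobius])

theorem mobiusHom_mul (M N : GL (Fin 2) ℂ) :
    mobiusHom (M * N) = (mobiusHom N).comp (mobiusHom M) := by
  refine algHom_ratFunc_ext ?_
  have hN := automorphyFactor_ne_zero N
  have hMN := automorphyFactor_ne_zero (M * N)
  have hM := (_root_.map_ne_zero (mobiusHom N)).2 (automorphyFactor_ne_zero M)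
  simp only [automorphyFactor, Matrix.GeneralLinearGroup.coe_mul, Matrix.mul_apply,
    Fin.sum_univ_two, map_add, map_mul, mobiusHom_C, mobiusHom_X] at hM hMN
  simp only [AlgHom.comp_apply, mobiusHom_X, mobius, map_div₀, map_add, map_mul, mobiusHom_C,
    Matrix.GeneralLinearGroup.coe_mul, Matrix.mul_apply, Fin.sum_univ_two] at hM ⊢
  rw [div_eq_div_iff hMN hM]
  rw [automorphyFactor] at hN
  field_simp
  ring

theorem mobiusHom_eq_of_mk_eq {M N : GL (Fin 2) ℂ}
    (h : Matrix.ProjGenLinGroup.mk M = Matrix.ProjGenLinGroup.mk N) :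
    mobiusHom M = mobiusHom N := by
  obtain ⟨u, rfl⟩ := Matrix.ProjGenLinGroup.mk_eq_mk_iff.1 h
  refine algHom_ratFunc_ext ?_
  have hM := automorphyFactor_ne_zero M
  have hN := automorphyFactor_ne_zero (M * Matrix.GeneralLinearGroup.scalar (Fin 2) u)
  rw [mobiusHom_X, mobiusHom_X, mobius, mobius, ← automorphyFactor, ← automorphyFactor,
    div_eq_div_iff hM hN]
  simp only [automorphyFactor, Units.val_mul, Matrix.GeneralLinearGroup.coe_scalar,
    Matrix.scalar_apply, Matrix.mul_apply, Fin.sum_univ_two, Matrix.diagonal_apply_eq, ne_eq,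
    one_ne_zero, not_false_eq_true, Matrix.diagonal_apply_ne, mul_zero, add_zero, map_mul,
    zero_ne_one, zero_add]
  ring

theorem mk_mul_self_of_orderOf_eq_two {n R : Type*} [Fintype n] [DecidableEq n] [CommRing R]
    {M : GL n R} (h : orderOf (Matrix.ProjGenLinGroup.mk M) = 2) :
    Matrix.ProjGenLinGroup.mk (M * M) = Matrix.ProjGenLinGroup.mk 1 := by
  rw [map_mul, ← pow_two, orderOf_dvd_iff_pow_eq_one.1 h.dvd, map_one]

theorem mobiusHom_mobiusHom_of_orderOf_eq_two {M : GL (Fin 2) ℂ}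
    (h : orderOf (Matrix.ProjGenLinGroup.mk M) = 2) (F : RatFunc ℂ) :
    mobiusHom M (mobiusHom M F) = F := by
  rw [← AlgHom.comp_apply, ← mobiusHom_mul,
    mobiusHom_eq_of_mk_eq (mk_mul_self_of_orderOf_eq_two h), mobiusHom_one, AlgHom.id_apply]

end Mobius

section LinearForms

theorem adjugate_eq_trace_smul_one_sub {R : Type*} [CommRing R] (M : Matrix (Fin 2) (Fin 2) R) :
    M.adjugate = M.trace • 1 - M := by
  ext i j
  fin_cases i <;> fin_cases j <;> simp [Matrix.adjugate_fin_two, Matrix.trace_fin_two]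

theorem trace_eq_zero_of_orderOf_eq_two {k : Type*} [Field k] {M : GL (Fin 2) k}
    (h : orderOf (Matrix.ProjGenLinGroup.mk M) = 2) :
    (M : Matrix (Fin 2) (Fin 2) k).trace = 0 := by
  set A := (M : Matrix (Fin 2) (Fin 2) k) with hA
  obtain ⟨u, hu⟩ := Matrix.ProjGenLinGroup.mk_eq_mk_iff.1 (mk_mul_self_of_orderOf_eq_two h).symm
  have hsq : A * A = (u : k) • 1 := by
    have := congr(($hu : Matrix (Fin 2) (Fin 2) k))
    rw [one_mul] at this
    rw [hA, ← Matrix.GeneralLinearGroup.coe_mul, ← this, Matrix.smul_one_eq_diagonal]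
    rfl
  by_contra htr
  have hscalar : A = ((u + A.det) / A.trace) • 1 := by
    have hCH := A.mul_adjugate
    rw [adjugate_eq_trace_smul_one_sub, mul_sub, hsq, Matrix.mul_smul, mul_one,
      sub_eq_iff_eq_add] at hCH
    rw [div_eq_inv_mul, mul_smul, eq_inv_smul_iff₀ htr, add_smul, hCH, add_comm]
  have hone : Matrix.ProjGenLinGroup.mk M = 1 := by
    rw [Matrix.ProjGenLinGroup.mk_eq_one,
      Matrix.GeneralLinearGroup.mem_center_iff_val_mem_range_scalar]
    exact ⟨_, by rw [Matrix.scalar_apply, ← Matrix.smul_one_eq_diagonal, ← hscalar]⟩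
  simp [hone] at h

/-- The polynomial of degree at most one whose root in `ℙ¹(k)` is the point with homogeneous
coordinates `v`. -/
def linearForm {k : Type*} [CommRing k] : (Fin 2 → k) →ₗ[k] k[X] where
  toFun v := C (v 1) * X - C (v 0)
  map_add' v w := by simp only [Pi.add_apply, map_add]; ring
  map_smul' c v := by
    simp only [Pi.smul_apply, smul_eq_mul, map_mul, RingHom.id_apply, smul_eq_C_mul]
    ring

theorem linearForm_apply {k : Type*} [CommRing k] (v : Fin 2 → k) :
    linearForm v = C (v 1) * X - C (v 0) :=
  rfl

theorem mobiusHom_linearForm (M : GL (Fin 2) ℂ) (v : Fin 2 → ℂ) :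
    mobiusHom M (algebraMap ℂ[X] (RatFunc ℂ) (linearForm v)) =
      algebraMap ℂ[X] (RatFunc ℂ)
        (linearForm ((M : Matrix (Fin 2) (Fin 2) ℂ).adjugate.mulVec v)) / automorphyFactor M := by
  rw [eq_div_iff (automorphyFactor_ne_zero M)]
  have hD := automorphyFactor_ne_zero M
  simp only [linearForm_apply, map_sub, map_mul, RatFunc.algebraMap_C, RatFunc.algebraMap_X,
    mobiusHom_C, mobiusHom_X, Matrix.adjugate_fin_two]
  rw [mobius, ← automorphyFactor]
  field_simp
  simp only [automorphyFactor, Matrix.mulVec, dotProduct, Matrix.of_apply, Matrix.cons_val',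
    Matrix.cons_val_fin_one, Matrix.cons_val_one, Fin.sum_univ_two, Matrix.cons_val_zero, neg_mul,
    map_add, map_neg, map_mul]
  ring

/-- The product of the linear forms of the points `v` and `S v`, where `S` is the Möbius
transformation given by `M`. -/
def pairPoly {k : Type*} [CommRing k] (M : GL (Fin 2) k) (v : Fin 2 → k) : k[X] :=
  linearForm v * linearForm ((M : Matrix (Fin 2) (Fin 2) k).mulVec v)

theorem pairPoly_smul {k : Type*} [CommRing k] (M : GL (Fin 2) k) (c : k) (v : Fin 2 → k) :
    pairPoly M (c • v) = C (c ^ 2) * pairPoly M v := by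
  simp only [pairPoly, Matrix.mulVec_smul, map_smul, smul_eq_C_mul, C_pow]
  ring

theorem natDegree_pairPoly_le {k : Type*} [CommRing k] (M : GL (Fin 2) k) (v : Fin 2 → k) :
    (pairPoly M v).natDegree ≤ 2 := by
  rw [pairPoly, linearForm_apply, linearForm_apply]
  compute_degree

theorem mobiusHom_pairPoly {M : GL (Fin 2) ℂ} (hM : (M : Matrix (Fin 2) (Fin 2) ℂ).trace = 0)
    (v : Fin 2 → ℂ) :
    mobiusHom M (algebraMap ℂ[X] (RatFunc ℂ) (pairPoly M v)) =
      -(mobius M)′ * algebraMap ℂ[X] (RatFunc ℂ) (pairPoly M v) := by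
  have hadj : (M : Matrix (Fin 2) (Fin 2) ℂ).adjugate.mulVec v =
      -(M : Matrix (Fin 2) (Fin 2) ℂ).mulVec v := by
    rw [adjugate_eq_trace_smul_one_sub, hM, zero_smul, zero_sub, Matrix.neg_mulVec]
  rw [pairPoly, map_mul, map_mul, mobiusHom_linearForm, mobiusHom_linearForm, hadj,
    Matrix.mulVec_mulVec, Matrix.adjugate_mul, Matrix.smul_mulVec, Matrix.one_mulVec, map_neg,
    map_smul, smul_eq_C_mul, map_neg, map_mul, RatFunc.algebraMap_C, deriv_mobius]
  ring

end LinearForms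

section AntiInvariant

theorem deriv_div_ne_zero {p q : ℂ[X]} (hpq : IsCoprime p q)
    (hdeg : p.natDegree ≠ 0 ∨ q.natDegree ≠ 0) :
    (algebraMap ℂ[X] (RatFunc ℂ) p / algebraMap ℂ[X] (RatFunc ℂ) q)′ ≠ 0 := by
  have hq0 : q ≠ 0 := by
    rintro rfl
    simp [natDegree_eq_zero_of_isUnit (isCoprime_zero_right.1 hpq)] at hdeg
  have hq : algebraMap ℂ[X] (RatFunc ℂ) q ≠ 0 := RatFunc.algebraMap_ne_zero hq0
  change ddt _ ≠ 0
  rw [ddt_div p q hq0]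
  intro h
  have hw : wronskian p q = 0 := by
    apply RatFunc.algebraMap_injective ℂ
    have := (div_eq_zero_iff.1 h).resolve_right (pow_ne_zero 2 hq)
    rw [wronskian, map_sub, map_mul, map_mul, map_zero]
    linear_combination -this
  obtain ⟨hp', hq'⟩ := hpq.wronskian_eq_zero_iff.1 hw
  exact hdeg.elim (· (derivative_eq_zero.1 hp'))
    (· (derivative_eq_zero.1 hq'))

theorem exists_eq_mul_deriv_mul_aeval_div {σ : RatFunc ℂ →ₐ[ℂ] RatFunc ℂ} {p q : ℂ[X]}
    (hp : p.natDegree ≤ 2) (hq : q.natDegree ≤ 2)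
    (hσp : σ (algebraMap ℂ[X] (RatFunc ℂ) p) = -(σ RatFunc.X)′ * algebraMap ℂ[X] (RatFunc ℂ) p)
    (hσq : σ (algebraMap ℂ[X] (RatFunc ℂ) q) = -(σ RatFunc.X)′ * algebraMap ℂ[X] (RatFunc ℂ) q)
    {v : RatFunc ℂ} (hv : v = algebraMap ℂ[X] (RatFunc ℂ) p / algebraMap ℂ[X] (RatFunc ℂ) q)
    (hv' : v′ ≠ 0) {F : RatFunc ℂ} (hF : σ F = -F) :
    ∃ f g : ℂ[X], F = algebraMap ℂ[X] (RatFunc ℂ) q * v′ * (aeval v f / aeval v g) := by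
  have hq0 : q ≠ 0 := by
    rintro rfl
    simp [hv] at hv'
  have hQ : algebraMap ℂ[X] (RatFunc ℂ) q ≠ 0 := RatFunc.algebraMap_ne_zero hq0
  have hσX : (σ RatFunc.X)′ ≠ 0 := fun h =>
    (_root_.map_ne_zero σ).2 hQ (by rw [hσq, h, neg_zero, zero_mul])
  have hσ : σ ≠ AlgHom.id ℂ (RatFunc ℂ) := by
    rintro rfl
    simp [deriv_ratFunc_X, self_eq_neg, hq0] at hσq
  have hσv : σ v = v := by
    rw [hv, map_div₀, hσp, hσq, mul_div_mul_left _ _ (neg_ne_zero.2 hσX)]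
  have hσv' : σ v′ * (σ RatFunc.X)′ = v′ := by
    rw [← deriv_map_ratFunc deriv_ratFunc_C, hσv]
  have hC : ¬∃ c, v = RatFunc.C c := by
    rintro ⟨c, rfl⟩
    exact hv' (deriv_ratFunc_C c)
  have hσN : σ (F / (algebraMap ℂ[X] (RatFunc ℂ) q * v′)) =
      F / (algebraMap ℂ[X] (RatFunc ℂ) q * v′) := by
    rw [map_div₀, map_mul, hσq, hF, mul_right_comm, neg_mul, mul_comm (σ RatFunc.X)′, hσv', neg_mul,
      mul_comm v′]
    exact neg_div_neg_eq F _
  obtain ⟨f, g, hfg⟩ := (IntermediateField.mem_adjoin_simple_iff ℂ _).1 <|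
    mem_adjoin_simple_of_apply_eq hσ hσv
      ((finrank_adjoin_div_eq_two hσ hp hq hq0 hv hσv hC).symm ▸ Nat.prime_two) hσN
  exact ⟨f, g, by rw [← hfg, mul_div_cancel₀ _ (mul_ne_zero hQ hv')]⟩

theorem algebraMap_mul_deriv_div_mem_liouvilleForms {k A K : Type*} [Field k] [IsAlgClosed k]
    [CharZero k] [Field A] [Differential A] [Field K] [Differential K] [Algebra A K]
    [DifferentialAlgebra A K] [Algebra k A] [Algebra k K] [IsScalarTower k A K]
    (hk : ∀ c : k, (algebraMap k K c)′ = 0) {q v : A} {y : K}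
    (hy : y ^ 2 = algebraMap A K (q ^ 2 * v)) (f g : k[X]) :
    algebraMap A K (q * v′ * (aeval v f / aeval v g)) / y ∈ liouvilleForms k K := by
  rcases eq_or_ne y 0 with rfl | hy0
  · simp
  have hq : algebraMap A K q ≠ 0 := by
    intro hq
    simp [hq, hy0] at hy
  obtain ⟨w, rfl⟩ : ∃ w, y = algebraMap A K q * w := ⟨y / algebraMap A K q, by field_simp⟩
  have hw : w ^ 2 = algebraMap A K v := by
    rw [mul_pow, map_mul, map_pow] at hy
    exact mul_left_cancel₀ (pow_ne_zero 2 hq) hy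
  have hv' : algebraMap A K v′ = 2 * w * w′ := by
    rw [← deriv_algebraMap, ← hw, Derivation.leibniz_pow]
    simp [mul_assoc]
  have h := (liouvilleForms k K).smul_mem 2 <|
    aeval_div_aeval_mul_deriv_mem_liouvilleForms hk w (expand k 2 f) (expand k 2 g)
  convert h using 1
  have hw0 := right_ne_zero_of_mul hy0
  rw [expand_aeval, expand_aeval, hw, aeval_algebraMap_apply, aeval_algebraMap_apply, map_mul,
    map_mul, hv', map_div₀, Algebra.smul_def, map_ofNat]
  field_simp

end AntiInvariant

section HomogeneousCoordinates

variable {k : Type*} [Field k]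

/-- Homogeneous coordinates of a point of `ℙ¹(k)`: `(r : 1)` for `r : k`, and `(1 : 0)` for `∞`. -/
def homogeneousCoords (x : OnePoint k) : Fin 2 → k :=
  x.elim ![1, 0] fun r => ![r, 1]

theorem homogeneousCoords_ne_zero (x : OnePoint k) : homogeneousCoords x ≠ 0 := by
  cases x <;> simp [homogeneousCoords]

theorem linearForm_homogeneousCoords_infty :
    linearForm (homogeneousCoords (OnePoint.infty : OnePoint k)) = -1 := by
  simp [homogeneousCoords, linearForm_apply]

theorem linearForm_homogeneousCoords_coe (r : k) :
    linearForm (homogeneousCoords (r : OnePoint k)) = X - C r := by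
  simp [homogeneousCoords, linearForm_apply]

variable [DecidableEq k]

theorem equivProjectivization_eq_mk_homogeneousCoords (x : OnePoint k) :
    OnePoint.equivProjectivization k x =
      .mk k (homogeneousCoords x) (homogeneousCoords_ne_zero x) := by
  cases x <;> rfl

theorem exists_smul_homogeneousCoords_smul (M : GL (Fin 2) k) (x : OnePoint k) :
    ∃ c : k, c • (M : Matrix (Fin 2) (Fin 2) k).mulVec (homogeneousCoords x) =
      homogeneousCoords (M • x) := by
  have h := OnePoint.equivProjectivization_smul (g := M) x
  rw [equivProjectivization_eq_mk_homogeneousCoords, equivProjectivization_eq_mk_homogeneousCoords,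
    Projectivization.smul_mk, Projectivization.mk_eq_mk_iff'] at h
  exact h

theorem exists_linearForm_mul_linearForm_smul (M : GL (Fin 2) k) (x : OnePoint k) :
    ∃ c : k, linearForm (homogeneousCoords x) * linearForm (homogeneousCoords (M • x)) =
      C c * pairPoly M (homogeneousCoords x) := by
  obtain ⟨c, hc⟩ := exists_smul_homogeneousCoords_smul M x
  refine ⟨c, ?_⟩
  rw [← hc, map_smul, smul_eq_C_mul, pairPoly]
  ring

end HomogeneousCoordinates

section ProjectiveAction

variable {k : Type*} [Field k] [DecidableEq k]

theorem scalar_smul_onePoint (u : kˣ) (x : OnePoint k) :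
    Matrix.GeneralLinearGroup.scalar (Fin 2) u • x = x := by
  cases x with
  | infty => simp [OnePoint.smul_infty_eq_ite]
  | coe c => simp [OnePoint.smul_some_eq_ite]

theorem smul_eq_of_mk_eq {M N : GL (Fin 2) k}
    (h : Matrix.ProjGenLinGroup.mk M = Matrix.ProjGenLinGroup.mk N) (x : OnePoint k) :
    M • x = N • x := by
  obtain ⟨u, rfl⟩ := Matrix.ProjGenLinGroup.mk_eq_mk_iff.1 h
  rw [mul_smul, scalar_smul_onePoint]

theorem fixpointPolynomial_eq_zero_of_card_lt {g : GL (Fin 2) k} {t : Finset k}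
    (ht : ∀ r ∈ t, g • (r : OnePoint k) = r) (hcard : g.fixpointPolynomial.natDegree < t.card) :
    g.fixpointPolynomial = 0 := by
  refine eq_zero_of_natDegree_lt_card_of_eval_eq_zero' _ t (fun r hr => ?_) hcard
  rw [← coe_aeval_eq_eval, Matrix.GeneralLinearGroup.fixpointPolynomial_aeval_eq_zero_iff]
  exact ht r hr

theorem mk_eq_one_of_smul_eq {g : GL (Fin 2) k} {s : Finset (OnePoint k)} (hs : 3 ≤ s.card)
    (h : ∀ x ∈ s, g • x = x) : Matrix.ProjGenLinGroup.mk g = 1 := by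
  classical
  rw [Matrix.ProjGenLinGroup.mk_eq_one,
    Matrix.GeneralLinearGroup.mem_center_iff_val_mem_range_scalar,
    ← Matrix.GeneralLinearGroup.fixpointPolynomial_eq_zero_iff]
  let t : Finset k := s.preimage (↑) OnePoint.coe_injective.injOn
  have hts : t.map ⟨((↑) : k → OnePoint k), OnePoint.coe_injective⟩ = s.erase OnePoint.infty := by
    ext x
    cases x <;> simp [t]
  have htcard : t.card = (s.erase OnePoint.infty).card := by rw [← hts, Finset.card_map]
  refine fixpointPolynomial_eq_zero_of_card_lt (t := t)
    (fun r hr => h r (Finset.mem_preimage.1 hr)) ?_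
  rw [htcard, Matrix.GeneralLinearGroup.fixpointPolynomial]
  by_cases hinf : OnePoint.infty ∈ s
  · rw [Finset.card_erase_of_mem hinf, OnePoint.smul_infty_eq_self_iff.1 (h _ hinf)]
    calc _ ≤ 1 := by rw [C_0, zero_mul, zero_add]; compute_degree
      _ < _ := by omega
  · rw [Finset.erase_eq_of_notMem hinf]
    calc _ ≤ 2 := by compute_degree
      _ < _ := by omega

theorem mk_eq_mk_of_smul_eq {M N : GL (Fin 2) k} {s : Finset (OnePoint k)} (hs : 3 ≤ s.card)
    (h : ∀ x ∈ s, M • x = N • x) :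
    Matrix.ProjGenLinGroup.mk M = Matrix.ProjGenLinGroup.mk N := by
  rw [← inv_mul_eq_one, ← map_inv, ← map_mul]
  exact mk_eq_one_of_smul_eq hs fun x hx => by rw [mul_smul, ← h x hx, inv_smul_smul]

end ProjectiveAction

section FourPoints

variable {α : Type*} {s : Finset α} {f g h : α → α}

theorem eq_insert_of_card_eq_four [DecidableEq α] (hs : s.card = 4) {a b c d : α}
    (ha : a ∈ s) (hb : b ∈ s) (hc : c ∈ s) (hd : d ∈ s) (hnodup : [a, b, c, d].Nodup) :
    s = {a, b, c, d} := by
  refine (Finset.eq_of_subset_of_card_le (by grind) ?_).symm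
  simpa [hs] using (List.toFinset_card_of_nodup hnodup).ge

/-- `f` permutes the elements of `s` in pairs. -/
def IsPairing (s : Finset α) (f : α → α) : Prop :=
  ∀ x ∈ s, f x ∈ s ∧ f x ≠ x ∧ f (f x) = x

theorem IsPairing.eq_insert [DecidableEq α] (hs : s.card = 4) (hf : IsPairing s f)
    {x y : α} (hx : x ∈ s) (hy : y ∈ s) (hyx : y ≠ x) (hyf : y ≠ f x) : s = {x, f x, y, f y} :=
  eq_insert_of_card_eq_four hs hx (hf x hx).1 hy (hf y hy).1 (by grind [IsPairing])

theorem IsPairing.eqOn_of_eq (hs : s.card = 4) (hf : IsPairing s f) (hg : IsPairing s g) {x : α}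
    (hx : x ∈ s) (hfg : f x = g x) : Set.EqOn f g s := by
  classical
  intro y hy
  by_cases hyx : y = x
  · rw [hyx, hfg]
  by_cases hyf : y = f x
  · rw [hyf, (hf x hx).2.2, hfg, (hg x hx).2.2]
  have hsf := hf.eq_insert hs hx hy hyx hyf
  have hgy := (hg y hy).1
  rw [hsf] at hgy
  grind [IsPairing]

theorem IsPairing.comp_eq (hs : s.card = 4) (hf : IsPairing s f) (hg : IsPairing s g)
    (hh : IsPairing s h) {x : α} (hx : x ∈ s) (hfg : f x ≠ g x) (hfh : f x ≠ h x)
    (hgh : g x ≠ h x) : f (g x) = h x := by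
  classical
  have hsx := eq_insert_of_card_eq_four hs hx (hf x hx).1 (hg x hx).1 (hh x hx).1
    (by grind [IsPairing])
  have hfgx := (hf _ (hg x hx).1).1
  rw [hsx] at hfgx
  grind [IsPairing]

theorem IsPairing.exists_prod_eq {M : Type*} [CommMonoid M] (hs : s.card = 4) (hf : IsPairing s f)
    (φ : α → M) : ∃ x y, ∏ z ∈ s, φ z = φ x * φ (f x) * (φ y * φ (f y)) := by
  classical
  obtain ⟨x, hx⟩ : s.Nonempty := Finset.card_pos.1 (by omega)
  obtain ⟨y, hy, hyn⟩ : ∃ y ∈ s, y ∉ ({x, f x} : Finset α) :=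
    Finset.exists_mem_notMem_of_card_lt_card (Finset.card_le_two.trans_lt (by omega))
  have hsxy : s = {x, f x, y, f y} := hf.eq_insert hs hx hy (by grind) (by grind)
  have hnodup : [x, f x, y, f y].Nodup := by grind [IsPairing]
  have hsList : s = [x, f x, y, f y].toFinset := by simp [hsxy]
  refine ⟨x, y, ?_⟩
  rw [hsList, List.prod_toFinset φ hnodup]
  simp [mul_assoc]

end FourPoints

section PairingInvolutions

theorem exists_finset_projRoots {R : ℂ[X]} (hdeg : R.natDegree = 3 ∨ R.natDegree = 4)
    (hsimple : R.Separable) : ∃ s : Finset (OnePoint ℂ), s.card = 4 ∧ ↑s = projRoots R ∧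
      ∃ c, R = C c * ∏ x ∈ s, linearForm (homogeneousCoords x) := by
  classical
  have hroots : R.roots.card = R.natDegree := splits_iff_card_roots.1 (IsAlgClosed.splits R)
  let t : Finset ℂ := ⟨R.roots, nodup_roots hsimple⟩
  have ht : t.card = R.natDegree := hroots
  have hmem : ∀ r, r ∈ t ↔ R.IsRoot r := fun r => mem_roots hsimple.ne_zero
  have hprod : R = C R.leadingCoeff * ∏ r ∈ t, (X - C r) :=
    (C_leadingCoeff_mul_prod_multiset_X_sub_C hroots).symm
  let s : Finset (OnePoint ℂ) := t.map ⟨((↑) : ℂ → OnePoint ℂ), OnePoint.coe_injective⟩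
  have hs : s.card = R.natDegree := by rw [Finset.card_map, ht]
  have hinf : OnePoint.infty ∉ s := by simp [s]
  have hsprod : ∏ x ∈ s, linearForm (homogeneousCoords x) = ∏ r ∈ t, (X - C r) := by
    simp [s, Finset.prod_map, linearForm_homogeneousCoords_coe]
  rcases hdeg with hdeg | hdeg
  · refine ⟨insert OnePoint.infty s, by rw [Finset.card_insert_of_notMem hinf, hs, hdeg], ?_,
      -R.leadingCoeff, ?_⟩
    · ext x
      simp [projRoots, s, hmem, hdeg, eq_comm, or_comm]
    · rw [Finset.prod_insert hinf, linearForm_homogeneousCoords_infty, hsprod, C_neg, neg_one_mul,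
        neg_mul_neg]
      exact hprod
  · refine ⟨s, by rw [hs, hdeg], ?_, R.leadingCoeff, by rw [hsprod]; exact hprod⟩
    ext x
    simp [projRoots, s, hmem, hdeg, eq_comm]

theorem IsPairingInvolution.isPairing {R : ℂ[X]} {M : GL (Fin 2) ℂ} (h : IsPairingInvolution R M)
    {s : Finset (OnePoint ℂ)} (hs : ↑s = projRoots R) : IsPairing s (M • ·) := by
  simp only [IsPairing, ← Finset.mem_coe, hs]
  refine fun x hx => ⟨(h.2 x hx).1, (h.2 x hx).2, ?_⟩
  rw [← mul_smul, smul_eq_of_mk_eq (mk_mul_self_of_orderOf_eq_two h.1), one_smul]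

theorem mk_mul_eq_of_isPairingInvolution {R : ℂ[X]} (hdeg : R.natDegree = 3 ∨ R.natDegree = 4)
    (hsimple : R.Separable) {M₁ M₂ M₃ : GL (Fin 2) ℂ} (h₁ : IsPairingInvolution R M₁)
    (h₂ : IsPairingInvolution R M₂) (h₃ : IsPairingInvolution R M₃)
    (h₁₂ : Matrix.ProjGenLinGroup.mk M₁ ≠ Matrix.ProjGenLinGroup.mk M₂)
    (h₁₃ : Matrix.ProjGenLinGroup.mk M₁ ≠ Matrix.ProjGenLinGroup.mk M₃)
    (h₂₃ : Matrix.ProjGenLinGroup.mk M₂ ≠ Matrix.ProjGenLinGroup.mk M₃) :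
    Matrix.ProjGenLinGroup.mk (M₁ * M₂) = Matrix.ProjGenLinGroup.mk M₃ := by
  obtain ⟨s, hcard, hs, -⟩ := exists_finset_projRoots hdeg hsimple
  have hne : ∀ {M N : GL (Fin 2) ℂ}, IsPairingInvolution R M → IsPairingInvolution R N →
      Matrix.ProjGenLinGroup.mk M ≠ Matrix.ProjGenLinGroup.mk N → ∀ x ∈ s, M • x ≠ N • x :=
    fun hM hN hMN x hx hMNx => hMN <| mk_eq_mk_of_smul_eq (by omega : 3 ≤ s.card) <|
      (hM.isPairing hs).eqOn_of_eq hcard (hN.isPairing hs) hx hMNx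
  refine mk_eq_mk_of_smul_eq (by omega : 3 ≤ s.card) fun x hx => ?_
  rw [mul_smul]
  exact (h₁.isPairing hs).comp_eq hcard (h₂.isPairing hs) (h₃.isPairing hs) hx
    (hne h₁ h₂ h₁₂ x hx) (hne h₁ h₃ h₁₃ x hx) (hne h₂ h₃ h₂₃ x hx)

theorem IsPairingInvolution.exists_eq_mul {R : ℂ[X]} (hdeg : R.natDegree = 3 ∨ R.natDegree = 4)
    (hsimple : R.Separable) {M : GL (Fin 2) ℂ} (h : IsPairingInvolution R M) :
    ∃ u v : Fin 2 → ℂ, R = pairPoly M u * pairPoly M v := by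
  obtain ⟨s, hcard, hs, c, hR⟩ := exists_finset_projRoots hdeg hsimple
  obtain ⟨x, y, hxy⟩ := (h.isPairing hs).exists_prod_eq hcard (linearForm <| homogeneousCoords ·)
  obtain ⟨a, ha⟩ := exists_linearForm_mul_linearForm_smul M x
  obtain ⟨b, hb⟩ := exists_linearForm_mul_linearForm_smul M y
  have hRab : R = C (c * (a * b)) *
      (pairPoly M (homogeneousCoords x) * pairPoly M (homogeneousCoords y)) := by
    rw [hR, hxy, ha, hb, C_mul, C_mul]
    ring
  obtain ⟨l, hl⟩ := IsAlgClosed.exists_pow_nat_eq (c * (a * b)) two_pos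
  exact ⟨l • homogeneousCoords x, homogeneousCoords y, by rw [pairPoly_smul, hl, mul_assoc, hRab]⟩

end PairingInvolutions

section SquareRoot

variable {K : Type*} [Field K] [Differential K] [Algebra (RatFunc ℂ) K]
  [DifferentialAlgebra (RatFunc ℂ) K] [Algebra ℂ K] [IsScalarTower ℂ (RatFunc ℂ) K]

theorem deriv_algebraMap_complex (c : ℂ) : (algebraMap ℂ K c)′ = 0 := by
  rw [IsScalarTower.algebraMap_apply ℂ (RatFunc ℂ) K, deriv_algebraMap,
    RatFunc.algebraMap_eq_C, deriv_ratFunc_C, map_zero]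

theorem algebraMap_div_mem_liouvilleForms {R : ℂ[X]}
    (hdeg : R.natDegree = 3 ∨ R.natDegree = 4) (hsimple : R.Separable) {M : GL (Fin 2) ℂ}
    (hM : IsPairingInvolution R M) {F : RatFunc ℂ} (hF : mobiusHom M F = -F) {y : K}
    (hy : y ^ 2 = algebraMap (RatFunc ℂ) K (algebraMap ℂ[X] (RatFunc ℂ) R)) :
    algebraMap (RatFunc ℂ) K F / y ∈ liouvilleForms ℂ K := by
  have htr := trace_eq_zero_of_orderOf_eq_two hM.1
  obtain ⟨u, w, rfl⟩ := hM.exists_eq_mul hdeg hsimple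
  set p := pairPoly M u
  set q := pairPoly M w
  have hp : p.natDegree ≤ 2 := natDegree_pairPoly_le M u
  have hq : q.natDegree ≤ 2 := natDegree_pairPoly_le M w
  have hpq : p.natDegree ≠ 0 := by
    have := natDegree_mul_le (p := p) (q := q)
    omega
  have hv' := deriv_div_ne_zero hsimple.isCoprime (.inl hpq)
  obtain ⟨f, g, rfl⟩ := exists_eq_mul_deriv_mul_aeval_div hp hq
    (mobiusHom_X M ▸ mobiusHom_pairPoly htr u) (mobiusHom_X M ▸ mobiusHom_pairPoly htr w) rfl hv' hF
  refine algebraMap_mul_deriv_div_mem_liouvilleForms deriv_algebraMap_complex ?_ f g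
  have hq0 : algebraMap ℂ[X] (RatFunc ℂ) q ≠ 0 :=
    RatFunc.algebraMap_ne_zero (right_ne_zero_of_mul hsimple.ne_zero)
  rw [hy, map_mul]
  congr 1
  field_simp

end SquareRoot

theorem exists_eq_add_of_add_add_add_eq_zero {k V : Type*} [Field k] [NeZero (2 : k)]
    [AddCommGroup V] [Module k V] {σ τ : V →ₗ[k] V} {x : V} (hσ : σ (σ x) = x)
    (hx : x + σ x + τ x + τ (σ x) = 0) : ∃ u v, x = u + v ∧ σ u = -u ∧ τ v = -v := by
  refine ⟨(2⁻¹ : k) • (x - σ x), (2⁻¹ : k) • (x + σ x), ?_, ?_, ?_⟩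
  · rw [← smul_add, sub_add_add_cancel, ← two_smul k x, inv_smul_smul₀ two_ne_zero]
  · rw [map_smul, map_sub, hσ, ← smul_neg, neg_sub]
  · rw [map_smul, map_add, ← smul_neg]
    congr 1
    rw [eq_neg_iff_add_eq_zero, ← hx]
    abel

end

end Goursat

theorem theorem3p5 (R : Polynomial ℂ) (hdeg : R.natDegree = 3 ∨ R.natDegree = 4)
    (hsimple : R.Separable)
    (M₁ M₂ M₃ : GL (Fin 2) ℂ)
    (h₁ : Goursat.IsPairingInvolution R M₁)
    (h₂ : Goursat.IsPairingInvolution R M₂)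
    (h₃ : Goursat.IsPairingInvolution R M₃)
    (h₁₂ : Matrix.ProjGenLinGroup.mk M₁ ≠ Matrix.ProjGenLinGroup.mk M₂)
    (h₁₃ : Matrix.ProjGenLinGroup.mk M₁ ≠ Matrix.ProjGenLinGroup.mk M₃)
    (h₂₃ : Matrix.ProjGenLinGroup.mk M₂ ≠ Matrix.ProjGenLinGroup.mk M₃)
    (F : RatFunc ℂ)
    (hF : F + Goursat.compMobius F M₁ + Goursat.compMobius F M₂ + Goursat.compMobius F M₃ = 0) :
    Goursat.IsPseudoElliptic R F := by
  intro K _ _ _ _ y hy _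
  let : Algebra ℂ K := ((algebraMap (RatFunc ℂ) K).comp (algebraMap ℂ (RatFunc ℂ))).toAlgebra
  have : IsScalarTower ℂ (RatFunc ℂ) K := .of_algebraMap_eq fun _ => rfl
  have hmul : Goursat.mobiusHom M₃ = (Goursat.mobiusHom M₂).comp (Goursat.mobiusHom M₁) := by
    rw [← Goursat.mobiusHom_mul, Goursat.mobiusHom_eq_of_mk_eq <|
      Goursat.mk_mul_eq_of_isPairingInvolution hdeg hsimple h₁ h₂ h₃ h₁₂ h₁₃ h₂₃]
  simp only [Goursat.compMobius_eq_mobiusHom, hmul, AlgHom.comp_apply] at hF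
  obtain ⟨G, H, rfl, hG, hH⟩ := Goursat.exists_eq_add_of_add_add_add_eq_zero
    (σ := (Goursat.mobiusHom M₁).toLinearMap) (τ := (Goursat.mobiusHom M₂).toLinearMap)
    (Goursat.mobiusHom_mobiusHom_of_orderOf_eq_two h₁.1 F) hF
  apply Goursat.hasElementaryIntegral_of_mem_liouvilleForms Goursat.deriv_algebraMap_complex
  rw [map_add, add_div]
  exact add_mem (Goursat.algebraMap_div_mem_liouvilleForms hdeg hsimple h₁ hG hy)
    (Goursat.algebraMap_div_mem_liouvilleForms hdeg hsimple h₂ hH hy)
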